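/- Let $n\in\mathbb N$ and let $\lVert\cdot\rVert$ be any norm on the space of real $n\times n$ matrices. An undirected weighted graph on the nodes $1,\dots,n$ is a simple graph with weights $w_{i,j}=w_{j,i}$, where $w_{i,j}>0$ if $(i,j)$ is an edge and $w_{i,j}=0$ otherwise. Its Laplacian is $L=D-W$, where $W=(w_{i,j})$ and $D=\mathrm{diag}(D_1,\dots,D_n)$ with $D_i=\sum_j w_{i,j}$. Let $\mathcal W$ be the set of Laplacians of connected undirected weighted graphs with $n$ nodes. For a symmetric real $n\times n$ matrix $M$ with zero row sums and a tuple $\mathscr E=(\epsilon_{i,j})_{1\le i<j\le n}\in\mathbb R^{n(n-1)/2}$, let $\underline M(\mathscr E)$ be the symmetric matrix with zero row sums whose entry at $(i,j)$, $i<j$, is $-\epsilon_{i,j}$ if $M_{i,j}\neq 0$ and $0$ otherwise. For sets $\mathcal M_0\subset\mathcal M$ of such matrices, $\mathcal M_0$ is structurally dense in $\mathcal M$ if for every $M\in\mathcal M$ and every $\epsilon_0>0$ there is $\mathscr E\in\mathbb R^{n(n-1)/2}$ with $M+\underline M(\mathscr E)\in\mathcal M_0$ and $\lVert\underline M(\mathscr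 E)\rVert<\epsilon_0$. A property is structurally generic in $\mathcal M$ if the set of matrices in $\mathcal M$ that have it is structurally dense in $\mathcal M$ and, for every $M\in\mathcal M$, the set of tuples $\mathscr E\in\mathbb R^{n(n-1)/2}$ such that $\underline M(\mathscr E)$ belongs to $\mathcal M$ and does not have the property has Lebesgue measure zero. Then the property of having a basis of eigenvectors with only non-zero entries is structurally generic in $\mathcal W$. Moreover, let $\mathcal W_a\subset\mathcal W$ be the set of those Laplacians in $\mathcal W$ for which there exists a basis of $\mathbb R^n$ consisting of eigenvectors, one of which has at least one zero entry. Then: - the set $\mathcal W_a^c\cap\mathcal W$ is structurally dense in $\mathcal W$; - for every $L\in\mathcal W$, the set of tuples $\mathscr E\in\mathbb R^{n(n-1)/2}$ such that $\underline L(\mathscr E)$ belongs to $\mathcal W_a$ has Lebesgue measure zero in $\mathbb R^{n(n-1)/2}$. -/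

import Mathlib

open MeasureTheory

noncomputable section

namespace WeightedLaplacian

/-- An undirected weighted simple graph on the nodes `0, …, n-1`: edges carry positive weights,
and `weight i j = 0` when `(i, j)` is not an edge (in particular there are no loops). -/
structure WeightedGraph (n : ℕ) where
  graph : SimpleGraph (Fin n)
  weight : Fin n → Fin n → ℝ
  weight_symm : ∀ i j, weight i j = weight j i
  weight_pos : ∀ i j, graph.Adj i j → 0 < weight i j
  weight_zero : ∀ i j, ¬ graph.Adj i j → weight i j = 0

/-- The Laplacian `D - W` of a weighted graph. -/
def WeightedGraph.laplacian {n : ℕ} (G : WeightedGraph n) : Matrix (Fin n) (Fin n) ℝ :=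
  Matrix.diagonal (fun i => ∑ j, G.weight i j) - Matrix.of G.weight

/-- Laplacians of connected undirected weighted graphs with `n` nodes. -/
def connectedLaplacians (n : ℕ) : Set (Matrix (Fin n) (Fin n) ℝ) :=
  {L | ∃ G : WeightedGraph n, G.graph.Connected ∧ G.laplacian = L}

/-- Symmetric real matrices all of whose rows sum to zero. -/
def symmZeroRowSum (n : ℕ) : Set (Matrix (Fin n) (Fin n) ℝ) :=
  {M | M.IsSymm ∧ ∀ i, ∑ j, M i j = 0}

/-- The pairs `i < j`; there are `n (n - 1) / 2` of them. -/
abbrev UpperPairs (n : ℕ) : Type := {p : Fin n × Fin n // p.1 < p.2}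

/-- Tuples `(ε i j)` indexed by the pairs `i < j`. -/
abbrev Tuple (n : ℕ) : Type := UpperPairs n → ℝ

/-- Off-diagonal part of the structural perturbation of `M` by the tuple `ε`: the entry at `i < j`
is `-ε i j` if `M i j ≠ 0` and `0` otherwise, extended symmetrically (with zero diagonal). -/
def perturbOffDiag {n : ℕ} (M : Matrix (Fin n) (Fin n) ℝ) (ε : Tuple n) (i j : Fin n) : ℝ :=
  open Classical in
  if h : i < j then (if M i j ≠ 0 then -ε ⟨(i, j), h⟩ else 0)
  else if h : j < i then (if M j i ≠ 0 then -ε ⟨(j, i), h⟩ else 0)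
  else 0

/-- The structural perturbation of `M` by the tuple `ε`: symmetric, with zero row sums. -/
def perturb {n : ℕ} (M : Matrix (Fin n) (Fin n) ℝ) (ε : Tuple n) : Matrix (Fin n) (Fin n) ℝ :=
  Matrix.of fun i j =>
    if i = j then -∑ k ∈ Finset.univ.erase i, perturbOffDiag M ε i k else perturbOffDiag M ε i j

/-- `S₀` is structurally dense in `S`, with smallness measured by `N`
(used for `S₀ ⊆ S ⊆ symmZeroRowSum n` and a norm `N`). -/
def StructurallyDense {n : ℕ} (N : Seminorm ℝ (Matrix (Fin n) (Fin n) ℝ))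
    (S₀ S : Set (Matrix (Fin n) (Fin n) ℝ)) : Prop :=
  ∀ M ∈ S, ∀ ε₀ : ℝ, 0 < ε₀ → ∃ ε : Tuple n, M + perturb M ε ∈ S₀ ∧ N (perturb M ε) < ε₀

/-- The property `P` is structurally generic in `S` (used for `S ⊆ symmZeroRowSum n`). -/
def StructurallyGeneric {n : ℕ} (N : Seminorm ℝ (Matrix (Fin n) (Fin n) ℝ))
    (P : Matrix (Fin n) (Fin n) ℝ → Prop) (S : Set (Matrix (Fin n) (Fin n) ℝ)) : Prop :=
  StructurallyDense N {M | M ∈ S ∧ P M} S ∧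
    ∀ M ∈ S, volume {ε : Tuple n | perturb M ε ∈ S ∧ ¬ P (perturb M ε)} = 0

/-- The basis `b` of `ℝⁿ` consists of eigenvectors of `L`. -/
def IsEigenbasis {n : ℕ} (L : Matrix (Fin n) (Fin n) ℝ)
    (b : Module.Basis (Fin n) ℝ (Fin n → ℝ)) : Prop :=
  ∀ k, ∃ μ : ℝ, Module.End.HasEigenvector (Matrix.toLin' L) μ (b k)

/-- `L` has a basis of eigenvectors all of whose entries are non-zero. -/
def HasNowhereZeroEigenbasis {n : ℕ} (L : Matrix (Fin n) (Fin n) ℝ) : Prop :=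
  ∃ b : Module.Basis (Fin n) ℝ (Fin n → ℝ), IsEigenbasis L b ∧ ∀ k i, b k i ≠ 0

/-- Laplacians of connected graphs for which there is a basis of eigenvectors, one of them
having at least one zero entry. -/
def laplaciansWithZeroEntry (n : ℕ) : Set (Matrix (Fin n) (Fin n) ℝ) :=
  {L | L ∈ connectedLaplacians n ∧
    ∃ b : Module.Basis (Fin n) ℝ (Fin n → ℝ), IsEigenbasis L b ∧ ∃ k i, b k i = 0}

/-- The ambient condition of structural density and genericity holds for connected Laplacians. -/
theorem connectedLaplacians_subset (n : ℕ) : connectedLaplacians n ⊆ symmZeroRowSum n := by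
  rintro L ⟨G, -, rfl⟩
  refine ⟨?_, fun i => ?_⟩
  · ext i j
    by_cases h : i = j
    · subst h; simp [WeightedGraph.laplacian]
    · simp [WeightedGraph.laplacian, h, Ne.symm h, G.weight_symm i j]
  · simp [WeightedGraph.laplacian, Matrix.diagonal_apply, Finset.sum_sub_distrib]

/-- Structural perturbations are symmetric with zero row sums. -/
theorem perturb_mem {n : ℕ} (M : Matrix (Fin n) (Fin n) ℝ) (ε : Tuple n) :
    perturb M ε ∈ symmZeroRowSum n := by
  refine ⟨?_, fun i => ?_⟩
  · ext i j
    rcases lt_trichotomy i j with h | h | h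
    · simp [perturb, perturbOffDiag, h, h.ne, h.ne', h.not_gt]
    · subst h; rfl
    · simp [perturb, perturbOffDiag, h, h.ne, h.ne', h.not_gt]
  · rw [← Finset.add_sum_erase _ _ (Finset.mem_univ i)]
    have : ∑ x ∈ Finset.univ.erase i, perturb M ε i x
        = ∑ x ∈ Finset.univ.erase i, perturbOffDiag M ε i x :=
      Finset.sum_congr rfl fun x hx => by
        simp [perturb, (Finset.ne_of_mem_erase hx).symm]
    rw [this]
    simp [perturb]

end WeightedLaplacian

end

open scoped Matrix

/-! For a vertex `r`, consider the determinant of the Krylov matrix with columns `A ^ k e_r`, `k <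
n`. If `A` is symmetric and it is non-zero, no eigenvector of `A` vanishes at `r`. So if it is
non-zero for every `r`, every eigenbasis is nowhere zero, and all the claims reduce to one: for
connected `M`, `krylovDet (perturb M ε) r` is non-zero for almost every `ε`.

This quantity is polynomial and homogeneous in `ε`, so one good tuple `η` suffices: every line in
direction `η` meets the zero set finitely often, and Fubini makes that set null
(`ae_krylovDet_perturb_ne_zero`). The tuple comes from `exists_weight_noBadEigenvector`, which grows
a tree from `r` by pendant edges of small weight, and from `krylovDet_ne_zero`. Density follows
because a null set has dense complement and positive tuples near the original weights keep the
graph. -/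

namespace WeightedLaplacian

/-! ### Krylov determinants and entries of eigenvectors. -/

section Krylov

variable {R S : Type*} [CommRing R] [CommRing S] {n : ℕ}

/-- The determinant of the Krylov matrix with columns `A ^ k e_r`, `k < n`. -/
def krylovDet (A : Matrix (Fin n) (Fin n) R) (r : Fin n) : R :=
  (Matrix.of fun i k : Fin n => (A ^ (k : ℕ)) i r).det

theorem map_krylovDet (f : R →+* S) (A : Matrix (Fin n) (Fin n) R) (r : Fin n) :
    f (krylovDet A r) = krylovDet (A.map f) r := by
  unfold krylovDet
  rw [RingHom.map_det]
  congr 1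
  ext i k
  have := congrFun (congrFun (map_pow f.mapMatrix A (k : ℕ)) i) r
  simpa using this

theorem krylovDet_smul (t : R) (A : Matrix (Fin n) (Fin n) R) (r : Fin n) :
    krylovDet (t • A) r = (∏ k : Fin n, t ^ (k : ℕ)) * krylovDet A r := by
  unfold krylovDet
  rw [← Matrix.det_mul_row]
  congr 1
  ext i k
  simp [smul_pow]

theorem eval_krylovDet_pencil (A B : Matrix (Fin n) (Fin n) R) (r : Fin n) (t : R) :
    (krylovDet (A.map Polynomial.C + (Polynomial.X : Polynomial R) • B.map Polynomial.C) r).eval t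
      = krylovDet (A + t • B) r := by
  rw [← Polynomial.coe_evalRingHom, map_krylovDet]
  congr 1
  ext i j
  simp only [Matrix.map_apply, Matrix.add_apply, Matrix.smul_apply, smul_eq_mul,
    Polynomial.coe_evalRingHom, Polynomial.eval_add, Polynomial.eval_mul, Polynomial.eval_C,
    Polynomial.eval_X]

/-- Along the direction of a matrix with non-vanishing Krylov determinant, every line meets the
zero set of the Krylov determinant in finitely many points. -/
theorem finite_krylovDet_eq_zero {K : Type*} [Field K] (A B : Matrix (Fin n) (Fin n) K)
    (r : Fin n) (hB : krylovDet B r ≠ 0) : {t : K | krylovDet (A + t • B) r = 0}.Finite := by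
  -- The pencil is reversed so that the value at `0` is `krylovDet B r ≠ 0`. Homogeneity then sends
  -- a zero `t ≠ 0` of the original pencil to a root `t⁻¹` of `p`.
  set p : Polynomial K :=
    krylovDet (B.map Polynomial.C + (Polynomial.X : Polynomial K) • A.map Polynomial.C) r with hp
  have hp0 : p ≠ 0 := by
    intro h
    have := eval_krylovDet_pencil B A r 0
    rw [← hp, h] at this
    simp at this
    exact hB this.symm
  have hfin : {s : K | p.eval s = 0}.Finite := by
    classical
    refine p.roots.toFinset.finite_toSet.subset fun s hs => ?_
    simpa [hp0] using hs
  refine ((Set.finite_singleton (0 : K)).union (hfin.image fun s => s⁻¹)).subset fun t ht => ?_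
  by_cases h0 : t = 0
  · exact Or.inl h0
  · refine Or.inr ⟨t⁻¹, ?_, inv_inv t⟩
    have h1 : A + t • B = t • (B + t⁻¹ • A) := by
      rw [smul_add, smul_smul, mul_inv_cancel₀ h0, one_smul, add_comm]
    have ht' : krylovDet (A + t • B) r = 0 := ht
    rw [h1, krylovDet_smul] at ht'
    have h2 : (∏ k : Fin n, t ^ (k : ℕ)) ≠ 0 :=
      Finset.prod_ne_zero_iff.mpr fun k _ => pow_ne_zero _ h0
    change p.eval t⁻¹ = 0
    rw [hp, eval_krylovDet_pencil]
    exact (mul_eq_zero.mp ht').resolve_left h2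

theorem vecMul_krylov_apply {A : Matrix (Fin n) (Fin n) R} (hA : A.IsSymm) (x : Fin n → R)
    (r k : Fin n) :
    (x ᵥ* Matrix.of fun i k : Fin n => (A ^ (k : ℕ)) i r) k = (A ^ (k : ℕ) *ᵥ x) r := by
  have h : (A ^ (k : ℕ))ᵀ = A ^ (k : ℕ) := by rw [Matrix.transpose_pow, hA.eq]
  rw [Matrix.vecMul, Matrix.mulVec, dotProduct_comm]
  congr 1
  ext i
  exact congrFun (congrFun h r) i

theorem pow_mulVec_of_eigen {A : Matrix (Fin n) (Fin n) R} {x : Fin n → R} {μ : R}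
    (h : A *ᵥ x = μ • x) (k : ℕ) : A ^ k *ᵥ x = μ ^ k • x := by
  induction k with
  | zero => simp
  | succ k ih => rw [pow_succ, ← Matrix.mulVec_mulVec, h, Matrix.mulVec_smul, ih, smul_smul,
      pow_succ, mul_comm]

/-- Multiplying the row vector `x` by the Krylov matrix gives the entries `(A ^ k x) r = μ ^ k * x
r`. If `x r = 0`, this contradicts invertibility. -/
theorem eigenvector_apply_ne_zero {K : Type*} [Field K] {A : Matrix (Fin n) (Fin n) K}
    (hA : A.IsSymm) {r : Fin n} (hr : krylovDet A r ≠ 0) {x : Fin n → K} (hx : x ≠ 0) {μ : K}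
    (h : A *ᵥ x = μ • x) : x r ≠ 0 := by
  intro h0
  refine hx (Matrix.eq_zero_of_vecMul_eq_zero hr ?_)
  ext k
  rw [vecMul_krylov_apply hA, pow_mulVec_of_eigen h]
  simp [h0]

/-- For a real symmetric matrix without eigenvectors vanishing at `r`, the vector `e_r` is
cyclic. -/
theorem krylovDet_ne_zero {A : Matrix (Fin n) (Fin n) ℝ} (hA : A.IsSymm) (r : Fin n)
    (h : ∀ (x : Fin n → ℝ) (μ : ℝ), A *ᵥ x = μ • x → x r = 0 → x = 0) : krylovDet A r ≠ 0 := by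
  intro hdet
  obtain ⟨v, hv0, hv⟩ := Matrix.exists_vecMul_eq_zero_iff.mpr hdet
  have hpow : ∀ k < n, (A ^ k *ᵥ v) r = 0 := fun k hk => by
    have := congrFun hv ⟨k, hk⟩
    rwa [vecMul_krylov_apply hA] at this
  -- By Cayley–Hamilton every power of `A` is a combination of the powers below `n`.
  have hall : ∀ k, (A ^ k *ᵥ v) r = 0 := fun k => by
    rw [A.pow_eq_aeval_mod_charpoly k, Polynomial.aeval_eq_sum_range' (n := n),
      Matrix.sum_mulVec, Finset.sum_apply]
    · refine Finset.sum_eq_zero fun m hm => ?_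
      rw [Matrix.smul_mulVec, Pi.smul_apply, hpow m (Finset.mem_range.mp hm), smul_zero]
    · have : 0 < n := Fin.pos r
      have hd := Polynomial.natDegree_modByMonic_lt (Polynomial.X ^ k) A.charpoly_monic (by
        intro h1
        have h2 := A.charpoly_natDegree_eq_dim
        rw [h1] at h2
        simp at h2
        omega)
      simpa using hd
  let T : EuclideanSpace ℝ (Fin n) →ₗ[ℝ] EuclideanSpace ℝ (Fin n) := A.toEuclideanLin
  have hTapp : ∀ x, (T x).ofLp = A *ᵥ x.ofLp := fun x => rfl
  have hT : T.IsSymmetric := by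
    refine Matrix.isSymmetric_toEuclideanLin_iff.mpr ?_
    rw [Matrix.IsHermitian, Matrix.conjTranspose_eq_transpose_of_trivial]
    exact hA
  -- The vectors whose whole orbit vanishes at `r` form an invariant subspace. Were it non-zero, the
  -- symmetric map would have an eigenvector in it, and that eigenvector would vanish at `r`.
  let W : Submodule ℝ (EuclideanSpace ℝ (Fin n)) :=
    { carrier := {x | ∀ k : ℕ, (A ^ k *ᵥ x.ofLp) r = 0}
      add_mem' := fun {x y} hx hy k => by
        simp only [Set.mem_ofPred_eq] at hx hy
        simp [Matrix.mulVec_add, hx k, hy k]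
      zero_mem' := fun k => by simp
      smul_mem' := fun c x hx k => by
        simp only [Set.mem_ofPred_eq] at hx
        simp [Matrix.mulVec_smul, hx k] }
  have hW : ∀ x ∈ W, T x ∈ W := fun x hx k => by
    have := hx (k + 1)
    rwa [pow_succ, ← Matrix.mulVec_mulVec] at this
  have hTW := hT.restrict_invariant hW
  have hsub : Subsingleton W := by
    refine hTW.subsingleton_of_no_eigenvalue_finiteDimensional fun μ => ?_
    rw [Submodule.eq_bot_iff]
    intro x hx
    rw [Module.End.mem_eigenspace_iff] at hx
    have hx' := congrArg (fun y : W => (y : EuclideanSpace ℝ (Fin n)).ofLp) hx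
    have h0 := h (x : EuclideanSpace ℝ (Fin n)).ofLp μ hx' (by simpa using x.2 0)
    ext i
    exact congrFun h0 i
  have hvW : WithLp.toLp 2 v ∈ W := hall
  have h3 : (⟨_, hvW⟩ : W) = 0 := Subsingleton.elim _ _
  exact hv0 (congrArg (fun y : W => (y : EuclideanSpace ℝ (Fin n)).ofLp) h3)

end Krylov

/-! ### Weights without eigenvectors vanishing at a given vertex. -/

section GoodWeights

variable {V : Type*} [Fintype V]

/-- The action of the Laplacian with weights `w` on the vector `x`. -/
def lapAct (w : V → V → ℝ) (x : V → ℝ) (i : V) : ℝ := ∑ j, w i j * (x i - x j)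

theorem sum_lapAct {w : V → V → ℝ} (hw : ∀ i j, w i j = w j i) (x : V → ℝ) :
    ∑ i, lapAct w x i = 0 := by
  have h : ∑ i, lapAct w x i = -∑ i, lapAct w x i := by
    simp only [lapAct]
    conv_lhs => rw [Finset.sum_comm]
    rw [← Finset.sum_neg_distrib]
    refine Finset.sum_congr rfl fun i _ => ?_
    rw [← Finset.sum_neg_distrib]
    refine Finset.sum_congr rfl fun j _ => ?_
    rw [hw j i]
    ring
  linarith

theorem lapAct_smul (w : V → V → ℝ) (c : ℝ) (x : V → ℝ) (i : V) :
    lapAct w (c • x) i = c * lapAct w x i := by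
  simp only [lapAct, Pi.smul_apply, smul_eq_mul, Finset.mul_sum]
  exact Finset.sum_congr rfl fun j _ => by ring

theorem lapAct_add_smul (w e : V → V → ℝ) (ε : ℝ) (x : V → ℝ) (i : V) :
    lapAct (fun i j => w i j + ε * e i j) x i = lapAct w x i + ε * lapAct e x i := by
  simp only [lapAct, Finset.mul_sum, ← Finset.sum_add_distrib]
  exact Finset.sum_congr rfl fun j _ => by ring

theorem continuous_lapAct (w : V → V → ℝ) (i : V) : Continuous fun x : V → ℝ => lapAct w x i := by
  unfold lapAct
  fun_prop

/-- No non-zero vector supported in `S` and vanishing at `r` is parallel to its image under the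
Laplacian with weights `w`. -/
def NoBadEigenvector (w : V → V → ℝ) (r : V) (S : Set V) : Prop :=
  ∀ x : V → ℝ, x r = 0 → (∀ i ∉ S, x i = 0) →
    (∀ i j, lapAct w x i * x j = lapAct w x j * x i) → x = 0

variable [DecidableEq V]

/-- Weight one on the edge `{p, l}`. -/
def edgeWeight (p l : V) (i j : V) : ℝ := if (i = p ∧ j = l) ∨ (i = l ∧ j = p) then 1 else 0

theorem lapAct_edgeWeight {p l : V} (hpl : p ≠ l) (x : V → ℝ) :
    lapAct (edgeWeight p l) x l = x l - x p := by
  unfold lapAct edgeWeight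
  rw [Finset.sum_eq_single p]
  · simp
  · intro j _ hj
    simp [hj, hpl.symm]
  · simp

/-- Attaching a pendant vertex `l` to the support `S` of the weights by an edge of sufficiently
small weight preserves the absence of bad eigenvectors. -/
theorem NoBadEigenvector.exists_insert {w : V → V → ℝ} {r p l : V} {S : Set V}
    (hsymm : ∀ i j, w i j = w j i) (hsupp : ∀ i ∉ S, ∀ j, w i j = 0) (hr : r ∈ S) (hp : p ∈ S)
    (hl : l ∉ S) (h : NoBadEigenvector w r S) :
    ∃ ε : ℝ, NoBadEigenvector (fun i j => w i j + ε * edgeWeight p l i j) r (insert l S) := by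
  have hpl : p ≠ l := fun e => hl (e ▸ hp)
  have hrl : r ≠ l := fun e => hl (e ▸ hr)
  have hwl : ∀ x, lapAct w x l = 0 := fun x =>
    Finset.sum_eq_zero fun j _ => by rw [hsupp l hl, zero_mul]
  set C : Set (V → ℝ) := Metric.sphere 0 1 ∩ {x | x r = 0 ∧ ∀ i ∉ insert l S, x i = 0} with hC
  have hCc : IsCompact C := by
    refine (isCompact_sphere 0 1).inter_right ?_
    have : {x : V → ℝ | x r = 0 ∧ ∀ i ∉ insert l S, x i = 0}
        = {x | x r = 0} ∩ ⋂ i, ⋂ (_ : i ∉ insert l S), {x | x i = 0} := by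
      ext x; simp
    rw [this]
    exact (isClosed_eq (continuous_apply r) continuous_const).inter
      (isClosed_iInter fun i => isClosed_iInter fun _ =>
        isClosed_eq (continuous_apply i) continuous_const)
  let L : ℝ → (V → ℝ) → V → ℝ := fun ε x i => lapAct w x i + ε * lapAct (edgeWeight p l) x i
  -- Parallelism alone fails to exclude `e_l` at `ε = 0`. Since the entries of `L ε x` sum to zero,
  -- parallelism gives `(L ε x) l * ∑ x = 0`, where `(L ε x) l = ε * (x l - x p)`. Dividing by `ε`
  -- leaves the second condition, which persists at `ε = 0`.
  let P : ℝ → (V → ℝ) → Prop := fun ε x =>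
    ¬ ((∀ i j, L ε x i * x j = L ε x j * x i) ∧ (x l - x p) * ∑ i, x i = 0)
  have hLc : ∀ i, Continuous fun z : ℝ × (V → ℝ) => L z.1 z.2 i := fun i =>
    ((continuous_lapAct w i).comp continuous_snd).add
      (continuous_fst.mul ((continuous_lapAct _ i).comp continuous_snd))
  have hPo : IsOpen {z : ℝ × (V → ℝ) | P z.1 z.2} := by
    have : {z : ℝ × (V → ℝ) | P z.1 z.2}
        = ((⋂ i, ⋂ j, {z : ℝ × (V → ℝ) | L z.1 z.2 i * z.2 j = L z.1 z.2 j * z.2 i}) ∩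
          {z | (z.2 l - z.2 p) * ∑ i, z.2 i = 0})ᶜ := by
      ext z
      simp [P]
    rw [this, isOpen_compl_iff]
    refine (isClosed_iInter fun i => isClosed_iInter fun j => isClosed_eq ?_ ?_).inter
      (isClosed_eq (by fun_prop) continuous_const)
    · exact (hLc i).mul (by fun_prop)
    · exact (hLc j).mul (by fun_prop)
  have hP0 : ∀ x ∈ C, P 0 x := by
    rintro x ⟨hx1, hxr, hxS⟩ ⟨hcol, hprod⟩
    -- At `ε = 0` the vertex `l` is isolated, so clearing this coordinate gives a bad vector for
    -- `S`, hence zero. Then `x` is a multiple of `e_l`, and the second condition reads `x l ^ 2 =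
    -- 0`.
    set y := Function.update x l 0 with hy
    have hyne : ∀ i, i ≠ l → y i = x i := fun i hi => by simp [hy, hi]
    have hyl : y l = 0 := by simp [hy]
    have hwy : ∀ i, lapAct w y i = lapAct w x i := fun i => by
      by_cases hi : i = l
      · rw [hi, hwl, hwl]
      · refine Finset.sum_congr rfl fun j _ => ?_
        by_cases hj : j = l
        · rw [hj, hsymm i l, hsupp l hl, zero_mul, zero_mul]
        · rw [hyne i hi, hyne j hj]
    have hy0 : y = 0 := by
      refine h y (by rw [hyne r hrl, hxr]) (fun i hi => ?_) fun i j => ?_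
      · by_cases hil : i = l
        · rw [hil, hyl]
        · rw [hyne i hil]
          exact hxS i (by simp [hil, hi])
      · rw [hwy, hwy]
        by_cases hi : i = l
        · rw [hi, hwl, hyl]; ring
        by_cases hj : j = l
        · rw [hj, hwl, hyl]; ring
        rw [hyne i hi, hyne j hj]
        simpa [L] using hcol i j
    have hx0 : ∀ i, i ≠ l → x i = 0 := fun i hi => by rw [← hyne i hi, hy0]; rfl
    have hsum : ∑ i, x i = x l :=
      Finset.sum_eq_single l (fun i _ hi => hx0 i hi) (by simp)
    have hxl : x l = 0 := by
      rw [hsum, hx0 p hpl, sub_zero] at hprod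
      exact mul_self_eq_zero.mp hprod
    have : x = 0 := by
      ext i
      by_cases hi : i = l
      · rw [hi, hxl]; rfl
      · exact hx0 i hi
    rw [this] at hx1
    simp at hx1
  -- Compactness of `C` makes the open condition hold for all `x` in `C` at once when `ε` is near
  -- `0`.
  have hev : ∀ᶠ ε in nhds (0 : ℝ), ∀ x ∈ C, P ε x :=
    hCc.eventually_forall_of_forall_eventually fun x hx => hPo.mem_nhds (hP0 x hx)
  obtain ⟨δ, hδ, hball⟩ := Metric.eventually_nhds_iff.mp hev
  have hε : ∀ x ∈ C, P (δ / 2) x := hball (by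
    rw [Real.dist_eq, sub_zero, abs_of_pos (by positivity)]; linarith)
  refine ⟨δ / 2, fun x hxr hxS hcol => ?_⟩
  by_contra hx
  have hn : ‖x‖ ≠ 0 := norm_ne_zero_iff.mpr hx
  have hL : ∀ x, lapAct (fun i j => w i j + δ / 2 * edgeWeight p l i j) x = L (δ / 2) x :=
    fun x => funext fun i => lapAct_add_smul w _ _ x i
  refine hε (‖x‖⁻¹ • x) ⟨?_, ?_, ?_⟩ ⟨fun i j => ?_, ?_⟩
  · simp [norm_smul, hn]
  · simp [hxr]
  · intro i hi
    simp [hxS i hi]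
  · rw [← hL, lapAct_smul, lapAct_smul, Pi.smul_apply, Pi.smul_apply, smul_eq_mul, smul_eq_mul]
    linear_combination ‖x‖⁻¹ * ‖x‖⁻¹ * hcol i j
  · have hs : ∑ i, lapAct (fun i j => w i j + δ / 2 * edgeWeight p l i j) x i = 0 :=
      sum_lapAct (fun i j => by
        rw [hsymm i j]
        simp only [edgeWeight]
        congr 3
        apply propext
        tauto) x
    have h1 : lapAct (fun i j => w i j + δ / 2 * edgeWeight p l i j) x l * ∑ i, x i = 0 := by
      rw [Finset.mul_sum, Finset.sum_congr rfl fun i _ => hcol l i, ← Finset.sum_mul, hs, zero_mul]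
    rw [lapAct_add_smul, hwl, zero_add, lapAct_edgeWeight hpl] at h1
    have h2 : (x l - x p) * ∑ i, x i = 0 := by
      rw [mul_assoc] at h1
      exact (mul_eq_zero.mp h1).resolve_left (by positivity)
    simp only [Pi.smul_apply, smul_eq_mul, ← Finset.mul_sum]
    linear_combination ‖x‖⁻¹ * ‖x‖⁻¹ * h2

/-- On a connected graph, suitable edge weights give a Laplacian none of whose eigenvectors
vanishes at the vertex `r`. -/
theorem exists_weight_noBadEigenvector {G : SimpleGraph V} (hG : G.Connected) (r : V) :
    ∃ w : V → V → ℝ, (∀ i j, w i j = w j i) ∧ (∀ i j, ¬ G.Adj i j → w i j = 0) ∧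
      NoBadEigenvector w r Set.univ := by
  have key : ∀ m < Fintype.card V, ∃ S : Finset V, S.card = m + 1 ∧ r ∈ S ∧ ∃ w : V → V → ℝ,
      (∀ i j, w i j = w j i) ∧ (∀ i j, ¬ G.Adj i j → w i j = 0) ∧
      (∀ i ∉ (S : Set V), ∀ j, w i j = 0) ∧ NoBadEigenvector w r S := by
    intro m
    induction m with
    | zero =>
      refine fun _ => ⟨{r}, by simp, by simp, fun _ _ => 0, by simp, by simp, by simp, ?_⟩
      intro x hxr hxS _
      ext i
      by_cases hi : i = r
      · rw [hi, hxr]; rfl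
      · exact hxS i (by simpa using hi)
    | succ m ih =>
      intro hm
      obtain ⟨S, hcard, hr, w, hsymm, hadj, hsupp, hbad⟩ := ih (by omega)
      obtain ⟨v, hv⟩ : ∃ v, v ∉ S := by
        by_contra! hall
        have : S = Finset.univ := Finset.eq_univ_iff_forall.mpr hall
        rw [this, Finset.card_univ] at hcard
        omega
      -- A walk from `r` to a vertex outside `S` must leave `S` along some edge, which supplies the
      -- pendant edge.
      obtain ⟨walk⟩ := hG.preconnected r v
      obtain ⟨d, -, hd1, hd2⟩ := walk.exists_boundary_dart (S : Set V) hr hv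
      have hda := d.adj
      generalize d.fst = p at *
      generalize d.snd = l at *
      obtain ⟨ε, hε⟩ := hbad.exists_insert hsymm hsupp hr hd1 hd2
      refine ⟨insert l S, by rw [Finset.card_insert_of_notMem hd2, hcard],
        Finset.mem_insert_of_mem hr, _, fun i j => ?_, fun i j hij => ?_, fun i hi j => ?_,
        by rw [Finset.coe_insert]; exact hε⟩
      · rw [hsymm i j]
        simp only [edgeWeight]
        congr 3
        apply propext
        tauto
      · have : edgeWeight p l i j = 0 := if_neg (by
          rintro (⟨rfl, rfl⟩ | ⟨rfl, rfl⟩)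
          exacts [hij hda, hij hda.symm])
        rw [hadj i j hij, this, mul_zero, add_zero]
      · have hi' : i ≠ l ∧ i ∉ (S : Set V) := by simpa using hi
        have : edgeWeight p l i j = 0 := if_neg (by
          rintro (⟨rfl, rfl⟩ | ⟨rfl, rfl⟩)
          exacts [hi'.2 hd1, hi'.1 rfl])
        rw [hsupp i hi'.2, this, mul_zero, add_zero]
  have hpos : 0 < Fintype.card V := Fintype.card_pos_iff.mpr ⟨r⟩
  obtain ⟨S, hcard, -, w, hsymm, hadj, -, hbad⟩ := key (Fintype.card V - 1) (by omega)
  have hS : S = Finset.univ := Finset.card_eq_iff_eq_univ S |>.mp (by omega)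
  subst hS
  exact ⟨w, hsymm, hadj, by simpa using hbad⟩

end GoodWeights

/-! ### Structural perturbations: null exceptional sets and density. -/

section Perturbation

variable {n : ℕ}

theorem perturb_apply_of_lt (M : Matrix (Fin n) (Fin n) ℝ) (ε : Tuple n) {i j : Fin n}
    (h : i < j) : perturb M ε i j = if M i j ≠ 0 then -ε ⟨(i, j), h⟩ else 0 := by
  simp [perturb, perturbOffDiag, h, h.ne]

/-- Matrices in `symmZeroRowSum n` are determined by their entries above the diagonal. -/
theorem eq_of_mem_symmZeroRowSum {A B : Matrix (Fin n) (Fin n) ℝ} (hA : A ∈ symmZeroRowSum n)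
    (hB : B ∈ symmZeroRowSum n) (h : ∀ i j, i < j → A i j = B i j) : A = B := by
  have hne : ∀ i j, i ≠ j → A i j = B i j := fun i j hij => by
    rcases lt_or_gt_of_ne hij with h' | h'
    · exact h i j h'
    · rw [← hA.1.apply, ← hB.1.apply, h j i h']
  ext i j
  by_cases hij : i = j
  · subst hij
    have h1 := hA.2 i
    have h2 := hB.2 i
    rw [← Finset.add_sum_erase _ _ (Finset.mem_univ i)] at h1 h2
    rw [Finset.sum_congr rfl fun k hk => hne i k (Finset.ne_of_mem_erase hk).symm] at h1
    linarith
  · exact hne i j hij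

theorem add_mem_symmZeroRowSum {A B : Matrix (Fin n) (Fin n) ℝ} (hA : A ∈ symmZeroRowSum n)
    (hB : B ∈ symmZeroRowSum n) : A + B ∈ symmZeroRowSum n :=
  ⟨hA.1.add hB.1, fun i => by simp [Finset.sum_add_distrib, hA.2 i, hB.2 i]⟩

theorem smul_mem_symmZeroRowSum {A : Matrix (Fin n) (Fin n) ℝ} (c : ℝ)
    (hA : A ∈ symmZeroRowSum n) : c • A ∈ symmZeroRowSum n :=
  ⟨hA.1.smul c, fun i => by simp [← Finset.mul_sum, hA.2 i]⟩

/-- The structural perturbation of `M` as a linear map. -/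
noncomputable def perturbLin (M : Matrix (Fin n) (Fin n) ℝ) : Tuple n →ₗ[ℝ] Matrix (Fin n) (Fin n) ℝ where
  toFun := perturb M
  map_add' a b := by
    refine eq_of_mem_symmZeroRowSum (perturb_mem _ _)
      (add_mem_symmZeroRowSum (perturb_mem _ _) (perturb_mem _ _)) fun i j h => ?_
    rw [Matrix.add_apply, perturb_apply_of_lt M _ h, perturb_apply_of_lt M _ h,
      perturb_apply_of_lt M _ h]
    split_ifs
    · simp [add_comm]
    · simp
  map_smul' c a := by
    refine eq_of_mem_symmZeroRowSum (perturb_mem _ _)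
      (smul_mem_symmZeroRowSum _ (perturb_mem _ _)) fun i j h => ?_
    rw [Matrix.smul_apply, perturb_apply_of_lt M _ h, perturb_apply_of_lt M _ h]
    split_ifs <;> simp

theorem perturbLin_apply (M : Matrix (Fin n) (Fin n) ℝ) (ε : Tuple n) :
    perturbLin M ε = perturb M ε := rfl

theorem continuous_perturb (M : Matrix (Fin n) (Fin n) ℝ) : Continuous (perturb M) :=
  (perturbLin M).continuous_of_finiteDimensional

/-- A symmetric matrix with zero row sums acts as the Laplacian whose weights are its negated
entries. -/
theorem mulVec_eq_lapAct {A : Matrix (Fin n) (Fin n) ℝ} (hA : A ∈ symmZeroRowSum n)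
    {w : Fin n → Fin n → ℝ} (hw : ∀ i j, i ≠ j → A i j = -w i j) (x : Fin n → ℝ) :
    A *ᵥ x = lapAct w x := by
  ext i
  have h : (A *ᵥ x) i = ∑ j, A i j * x j - (∑ j, A i j) * x i := by
    rw [hA.2 i, zero_mul, sub_zero]; rfl
  rw [h, Finset.sum_mul, ← Finset.sum_sub_distrib, lapAct]
  refine Finset.sum_congr rfl fun j _ => ?_
  by_cases hij : i = j
  · subst hij; ring
  · rw [hw i j hij]; ring

theorem laplacian_apply_of_ne (G : WeightedGraph n) {i j : Fin n} (h : i ≠ j) :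
    G.laplacian i j = -G.weight i j := by
  simp [WeightedGraph.laplacian, h]

theorem laplacian_apply_ne_zero_iff (G : WeightedGraph n) {i j : Fin n} (h : i ≠ j) :
    G.laplacian i j ≠ 0 ↔ G.graph.Adj i j := by
  rw [laplacian_apply_of_ne G h, neg_ne_zero]
  refine ⟨fun h0 => ?_, fun h0 => (G.weight_pos i j h0).ne'⟩
  by_contra hadj
  exact h0 (G.weight_zero i j hadj)

/-- The good weights need not be positive: `η` serves only as a direction, so `perturb M η` may lie
outside the connected Laplacians. -/
theorem exists_krylovDet_perturb_ne_zero {M : Matrix (Fin n) (Fin n) ℝ}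
    (hM : M ∈ connectedLaplacians n) (r : Fin n) : ∃ η, krylovDet (perturb M η) r ≠ 0 := by
  obtain ⟨G, hG, rfl⟩ := hM
  obtain ⟨w, hsymm, hadj, hbad⟩ := exists_weight_noBadEigenvector hG r
  refine ⟨fun p => w p.1.1 p.1.2, krylovDet_ne_zero (perturb_mem _ _).1 r fun x μ hx hr => ?_⟩
  have hlt : ∀ i j, i < j → perturb G.laplacian (fun p => w p.1.1 p.1.2) i j = -w i j := by
    intro i j h
    rw [perturb_apply_of_lt _ _ h]
    split_ifs with h0
    · rfl
    · rw [laplacian_apply_ne_zero_iff G h.ne] at h0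
      rw [hadj i j h0, neg_zero]
  rw [mulVec_eq_lapAct (w := w) (perturb_mem _ _)] at hx
  · refine hbad x hr (fun i hi => absurd (Set.mem_univ i) hi) fun i j => ?_
    rw [hx]
    simp only [Pi.smul_apply, smul_eq_mul]
    ring
  · intro i j hij
    rcases lt_or_gt_of_ne hij with h | h
    · exact hlt i j h
    · rw [← (perturb_mem _ _).1.apply, hlt j i h, hsymm]

theorem ae_krylovDet_perturb_ne_zero {M : Matrix (Fin n) (Fin n) ℝ}
    (hM : M ∈ connectedLaplacians n) :
    ∀ᵐ ε : Tuple n, ∀ r, krylovDet (perturb M ε) r ≠ 0 := by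
  rw [ae_all_iff]
  intro r
  obtain ⟨η, hη⟩ := exists_krylovDet_perturb_ne_zero hM r
  have hcont : Continuous fun ε : Tuple n => krylovDet (perturb M ε) r := by
    unfold krylovDet
    refine Continuous.matrix_det (continuous_matrix fun i k => ?_)
    exact ((continuous_perturb M).pow _).matrix_elem i r
  -- Fubini along direction `η`: it suffices that on each line almost every parameter is good.
  refine ae_mem_of_ae_add_linearMap_mem (s := {ε : Tuple n | krylovDet (perturb M ε) r ≠ 0})
    (LinearMap.toSpanSingleton ℝ (Tuple n) η) volume volume
    (isOpen_ne_fun hcont continuous_const).measurableSet fun y => ?_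
  have hfin := finite_krylovDet_eq_zero (perturb M y) (perturb M η) r hη
  filter_upwards [hfin.countable.ae_notMem volume] with t ht
  rw [LinearMap.toSpanSingleton_apply, ← perturbLin_apply, map_add, map_smul]
  exact ht

theorem perturb_mem_connectedLaplacians {M : Matrix (Fin n) (Fin n) ℝ}
    (hM : M ∈ connectedLaplacians n) {η : Tuple n} (hη : ∀ p, 0 < η p) :
    perturb M η ∈ connectedLaplacians n := by
  classical
  obtain ⟨G, hG, rfl⟩ := hM
  have hlt : ∀ i j (h : i < j), G.graph.Adj i j →
      perturb G.laplacian η i j = -η ⟨(i, j), h⟩ := fun i j h hadj => by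
    rw [perturb_apply_of_lt _ _ h, if_pos ((laplacian_apply_ne_zero_iff G h.ne).mpr hadj)]
  have hneg : ∀ i j, G.graph.Adj i j → perturb G.laplacian η i j < 0 := fun i j hadj => by
    rcases lt_or_gt_of_ne hadj.ne with h | h
    · rw [hlt i j h hadj]
      exact neg_neg_of_pos (hη _)
    · rw [← (perturb_mem _ _).1.apply, hlt j i h hadj.symm]
      exact neg_neg_of_pos (hη _)
  let H : WeightedGraph n :=
    { graph := G.graph
      weight := fun i j => if G.graph.Adj i j then -perturb G.laplacian η i j else 0
      weight_symm := fun i j => by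
        simp only [G.graph.adj_comm i j, (perturb_mem G.laplacian η).1.apply j i]
      weight_pos := fun i j h => by
        rw [if_pos h]
        exact neg_pos.mpr (hneg i j h)
      weight_zero := fun i j h => if_neg h }
  have hH : H.laplacian ∈ connectedLaplacians n := ⟨H, hG, rfl⟩
  convert hH using 1
  refine eq_of_mem_symmZeroRowSum (perturb_mem _ _) (connectedLaplacians_subset n hH)
    fun i j h => ?_
  rw [laplacian_apply_of_ne H h.ne]
  by_cases hadj : G.graph.Adj i j
  · simp [H, hadj]
  · rw [perturb_apply_of_lt _ _ h, if_neg (by rwa [laplacian_apply_ne_zero_iff G h.ne])]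
    simp [H, hadj]

/-- A Laplacian is its own structural perturbation by a positive tuple. -/
theorem exists_pos_perturb_eq_self {M : Matrix (Fin n) (Fin n) ℝ}
    (hM : M ∈ connectedLaplacians n) : ∃ η : Tuple n, (∀ p, 0 < η p) ∧ perturb M η = M := by
  classical
  have hM' := connectedLaplacians_subset n hM
  obtain ⟨G, -, rfl⟩ := hM
  -- The value `1` off the edges is ignored by `perturb` and only keeps the tuple positive.
  refine ⟨fun p => if G.graph.Adj p.1.1 p.1.2 then G.weight p.1.1 p.1.2 else 1, fun p => ?_,
    eq_of_mem_symmZeroRowSum (perturb_mem _ _) hM' fun i j h => ?_⟩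
  · dsimp only
    split_ifs with hp
    · exact G.weight_pos _ _ hp
    · exact one_pos
  · rw [perturb_apply_of_lt _ _ h]
    split_ifs with h1 h2
    · exact (laplacian_apply_of_ne G h.ne).symm
    · exact absurd ((laplacian_apply_ne_zero_iff G h.ne).mp h1) h2
    · exact (not_not.mp h1).symm

/-- Arbitrarily small structural perturbations yield connected Laplacians all of whose Krylov
determinants are non-zero. -/
theorem structurallyDense_krylovDet_ne_zero (N : Seminorm ℝ (Matrix (Fin n) (Fin n) ℝ)) :
    StructurallyDense N {M | M ∈ connectedLaplacians n ∧ ∀ r, krylovDet M r ≠ 0}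
      (connectedLaplacians n) := by
  intro M hM ε₀ hε₀
  obtain ⟨η, hη, hMη⟩ := exists_pos_perturb_eq_self hM
  -- As `perturb M η = M`, the perturbation `ε - η` turns `M` into `perturb M ε`. Its size is
  -- continuous in `ε`, being a seminorm on a finite-dimensional space, and vanishes at `η`.
  have hN : Continuous fun ε : Tuple n => N (perturb M (ε - η)) :=
    ((N.comp (perturbLin M)).convexOn.locallyLipschitz.continuous).comp
      (continuous_id.sub continuous_const)
  have hopen : IsOpen {ε : Tuple n | (∀ p, 0 < ε p) ∧ N (perturb M (ε - η)) < ε₀} := by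
    have : {ε : Tuple n | (∀ p, 0 < ε p) ∧ N (perturb M (ε - η)) < ε₀}
        = (⋂ p, {ε | 0 < ε p}) ∩ {ε | N (perturb M (ε - η)) < ε₀} := by
      ext ε; simp
    rw [this]
    exact (isOpen_iInter_of_finite fun p => isOpen_lt continuous_const (continuous_apply p)).inter
      (isOpen_lt hN continuous_const)
  have hmem : η ∈ {ε : Tuple n | (∀ p, 0 < ε p) ∧ N (perturb M (ε - η)) < ε₀} := by
    refine ⟨hη, ?_⟩
    rwa [sub_self, ← perturbLin_apply, map_zero, map_zero]
  obtain ⟨ε, ⟨hpos, hsmall⟩, hdet⟩ :=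
    (Measure.dense_of_ae (ae_krylovDet_perturb_ne_zero hM)).inter_open_nonempty _ hopen ⟨η, hmem⟩
  have heq : M + perturb M (ε - η) = perturb M ε := by
    rw [← perturbLin_apply, map_sub, perturbLin_apply, perturbLin_apply, hMη, add_sub_cancel]
  refine ⟨ε - η, ?_, hsmall⟩
  rw [heq]
  exact ⟨perturb_mem_connectedLaplacians hM hpos, hdet⟩

theorem IsEigenbasis.apply_ne_zero {A : Matrix (Fin n) (Fin n) ℝ} (hA : A.IsSymm)
    (hdet : ∀ r, krylovDet A r ≠ 0) {b : Module.Basis (Fin n) ℝ (Fin n → ℝ)}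
    (hb : IsEigenbasis A b) (k i : Fin n) : b k i ≠ 0 := by
  obtain ⟨μ, hμ⟩ := hb k
  exact eigenvector_apply_ne_zero hA (hdet i) hμ.2 (by simpa using hμ.apply_eq_smul)

theorem exists_isEigenbasis {A : Matrix (Fin n) (Fin n) ℝ} (hA : A.IsSymm) :
    ∃ b, IsEigenbasis A b := by
  have hH : A.IsHermitian := by
    rw [Matrix.IsHermitian, Matrix.conjTranspose_eq_transpose_of_trivial]
    exact hA
  refine ⟨hH.eigenvectorBasis.toBasis.map (WithLp.linearEquiv 2 ℝ (Fin n → ℝ)), fun k =>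
    ⟨hH.eigenvalues k, ?_, Module.Basis.ne_zero _ k⟩⟩
  rw [Module.End.mem_eigenspace_iff]
  simpa using hH.mulVec_eigenvectorBasis k

theorem hasNowhereZeroEigenbasis_of_krylovDet_ne_zero {A : Matrix (Fin n) (Fin n) ℝ}
    (hA : A.IsSymm) (hdet : ∀ r, krylovDet A r ≠ 0) : HasNowhereZeroEigenbasis A :=
  let ⟨b, hb⟩ := exists_isEigenbasis hA
  ⟨b, hb, hb.apply_ne_zero hA hdet⟩

theorem notMem_laplaciansWithZeroEntry_of_krylovDet_ne_zero {A : Matrix (Fin n) (Fin n) ℝ}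
    (hA : A.IsSymm) (hdet : ∀ r, krylovDet A r ≠ 0) : A ∉ laplaciansWithZeroEntry n :=
  fun ⟨_, _, hb, k, i, h⟩ => hb.apply_ne_zero hA hdet k i h

end Perturbation

end WeightedLaplacian

theorem corollary1 (n : ℕ) (N : Seminorm ℝ (Matrix (Fin n) (Fin n) ℝ))
    (hN : ∀ A : Matrix (Fin n) (Fin n) ℝ, N A = 0 → A = 0) :
    WeightedLaplacian.StructurallyGeneric N WeightedLaplacian.HasNowhereZeroEigenbasis
        (WeightedLaplacian.connectedLaplacians n) ∧
      WeightedLaplacian.StructurallyDense N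
        ((WeightedLaplacian.laplaciansWithZeroEntry n)ᶜ ∩ WeightedLaplacian.connectedLaplacians n)
        (WeightedLaplacian.connectedLaplacians n) ∧
      ∀ L ∈ WeightedLaplacian.connectedLaplacians n,
        MeasureTheory.volume {ε : WeightedLaplacian.Tuple n |
          WeightedLaplacian.perturb L ε ∈ WeightedLaplacian.laplaciansWithZeroEntry n} = 0 := by
  have hsymm : ∀ M ∈ WeightedLaplacian.connectedLaplacians n, M.IsSymm := fun M hM =>
    (WeightedLaplacian.connectedLaplacians_subset n hM).1
  refine ⟨⟨fun M hM ε₀ hε₀ => ?_, fun M hM => ?_⟩, fun M hM ε₀ hε₀ => ?_, fun M hM => ?_⟩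
  · obtain ⟨ε, ⟨hmem, hdet⟩, hsmall⟩ :=
      WeightedLaplacian.structurallyDense_krylovDet_ne_zero N M hM ε₀ hε₀
    exact ⟨ε, ⟨hmem, WeightedLaplacian.hasNowhereZeroEigenbasis_of_krylovDet_ne_zero
      (hsymm _ hmem) hdet⟩, hsmall⟩
  · refine MeasureTheory.measure_mono_null ?_
      (MeasureTheory.ae_iff.mp (WeightedLaplacian.ae_krylovDet_perturb_ne_zero hM))
    intro ε hε hdet
    exact hε.2 (WeightedLaplacian.hasNowhereZeroEigenbasis_of_krylovDet_ne_zero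
      (hsymm _ hε.1) hdet)
  · obtain ⟨ε, ⟨hmem, hdet⟩, hsmall⟩ :=
      WeightedLaplacian.structurallyDense_krylovDet_ne_zero N M hM ε₀ hε₀
    exact ⟨ε, ⟨WeightedLaplacian.notMem_laplaciansWithZeroEntry_of_krylovDet_ne_zero
      (hsymm _ hmem) hdet, hmem⟩, hsmall⟩
  · refine MeasureTheory.measure_mono_null ?_
      (MeasureTheory.ae_iff.mp (WeightedLaplacian.ae_krylovDet_perturb_ne_zero hM))
    intro ε hε hdet
    exact WeightedLaplacian.notMem_laplaciansWithZeroEntry_of_krylovDet_ne_zero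
      (hsymm _ hε.1) hdet hε
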